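/- Let $s\ge 2$ and $t\ge 1$ be coprime integers. A partition is a weakly decreasing sequence $\lambda=(\lambda_1,\lambda_2,\dots)$ of non-negative integers with finite sum; $\mathcal P$ is the set of partitions. For $r\in\mathbb Z$ put $\mathcal B_r(\lambda)=\{\lambda_i-i+r : i\ge 1\}$ and $\mathcal B(\lambda)=\mathcal B_0(\lambda)$. Let $W_s$ be the Coxeter group of type $\tilde A_{s-1}$, with generators $w_i$ ($i\in\mathbb Z/s\mathbb Z$) and relations $w_i^2=1$; $w_iw_j=w_jw_i$ if $j\ne i\pm1$; $w_iw_jw_i=w_jw_iw_j$ if $j=i+1\ne i-1$. With $c=\frac12(s-1)(t-1)$, the level $t$ action of $W_s$ on $\mathbb Z$ is given by: $w_i n=n+t$ if $n\equiv(i-1)t-c \pmod s$; $w_i n=n-t$ if $n\equiv it-c\pmod s$; $w_i n=n$ otherwise. It induces an action on $\mathcal P$ determined by $\mathcal B(w\lambda)=w\,\mathcal B(\lambda)$; its orbits are called level $t$ orbits. The $s$-core of $\lambda$ is the partition obtained from $\lambda$ by repeatedly removing rim $s$-hooks (connected subsets of size $s$ of the rim whose removal leaves the Young diagram of a partition) until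 none remain. For $i\in\mathbb Z/s\mathbb Z$ let $e_i(\lambda)$ be the smallest integer in the residue class $i$ that is not in $\mathcal B(\sigma)$, where $\sigma$ is the $s$-core of $\lambda$ (the $e_i(\lambda)$ form the $s$-set of $\lambda$), and let $\lambda^{(i)}$ be the component of the $s$-quotient of $\lambda$ at $i$: writing $i=a+s\mathbb Z$, it is the partition $\nu$ such that $\{(b-a)/s : b\in\mathcal B(\lambda)\cap i\}=\mathcal B_r(\nu)$ for some $r\in\mathbb Z$ (it does not depend on the choice of $a$). The $t$-weighted $s$-quotient of $\lambda$ is the multiset $[\,(e_i(\lambda)+t\mathbb Z,\ \lambda^{(i)}) : i\in\mathbb Z/s\mathbb Z\,]$ of elements of $\mathbb Z/t\mathbb Z\times\mathcal P$. **Proposition.** Two partitions $\lambda,\mu$ lie in the same level $t$ orbit of $W_s$ if and only if they have the same $t$-weighted $s$-quotient. -/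

import Mathlib

/-! ### Partitions, beta-sets

A partition `la` is represented by its Young diagram; with `0`-based indexing its parts are
`la.rowLen 0 ≥ la.rowLen 1 ≥ …`, so that the part usually written `la_i` is `la.rowLen (i - 1)`. -/

/-- The beta-set with charge `r`: all integers `la_i - i + r` for `i = 1, 2, 3, …`. -/
def betaSet (r : ℤ) (la : YoungDiagram) : Set ℤ :=
  Set.range fun i : ℕ => (la.rowLen i : ℤ) - ((i : ℤ) + 1) + r

theorem rowLen_eventually_zero (la : YoungDiagram) : ∃ N : ℕ, ∀ i, N ≤ i → la.rowLen i = 0 := by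
  refine ⟨la.colLen 0, fun i hi => ?_⟩
  by_contra h
  have h1 : (i, 0) ∈ la := YoungDiagram.mem_iff_lt_rowLen.2 (Nat.pos_of_ne_zero h)
  have h2 := YoungDiagram.mem_iff_lt_colLen.1 h1
  omega

theorem exists_youngDiagram_rowLen (f : ℕ → ℕ) (hf : Antitone f) (N : ℕ)
    (hN : ∀ i, N ≤ i → f i = 0) : ∃ la : YoungDiagram, ∀ i, la.rowLen i = f i := by
  classical
  let la : YoungDiagram :=
    { cells := (Finset.range N ×ˢ Finset.range (f 0)).filter fun c => c.2 < f c.1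
      isLowerSet := by
        rintro ⟨a, b⟩ ⟨c, d⟩ hle hmem
        obtain ⟨h1, h2⟩ := Prod.mk_le_mk.1 hle
        simp only [Finset.coe_filter, Finset.mem_product, Finset.mem_range, Set.mem_ofPred_eq]
          at hmem ⊢
        have := hf h1
        omega }
  refine ⟨la, fun i => ?_⟩
  have key : ∀ j, j < la.rowLen i ↔ j < f i := by
    intro j
    rw [← YoungDiagram.mem_iff_lt_rowLen]
    change (i, j) ∈ (Finset.range N ×ˢ Finset.range (f 0)).filter (fun c => c.2 < f c.1) ↔ _
    simp only [Finset.mem_filter, Finset.mem_product, Finset.mem_range]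
    constructor
    · exact fun h => h.2
    · intro h
      have h0 := hf (Nat.zero_le i)
      have : i < N := by
        by_contra hc
        have := hN i (by omega)
        omega
      omega
  have h1 := key (f i)
  have h2 := key (la.rowLen i)
  omega

theorem betaSet_strictAnti (r : ℤ) (la : YoungDiagram) :
    StrictAnti fun i : ℕ => (la.rowLen i : ℤ) - ((i : ℤ) + 1) + r := by
  intro i j hij
  have := la.rowLen_anti i j hij.le
  show (la.rowLen j : ℤ) - ((j : ℤ) + 1) + r < (la.rowLen i : ℤ) - ((i : ℤ) + 1) + r
  omega

/-- A partition and its charge are determined by the beta-set. -/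
theorem betaSet_inj {r r' : ℤ} {la mu : YoungDiagram} (h : betaSet r la = betaSet r' mu) :
    r = r' ∧ la = mu := by
  have h1 : StrictMono fun i : ℕ =>
      OrderDual.toDual ((la.rowLen i : ℤ) - ((i : ℤ) + 1) + r) := betaSet_strictAnti r la
  have h2 : StrictMono fun i : ℕ =>
      OrderDual.toDual ((mu.rowLen i : ℤ) - ((i : ℤ) + 1) + r') := betaSet_strictAnti r' mu
  have h3 := (StrictMono.range_inj h1 h2).1 h
  have h4 : ∀ i : ℕ, (la.rowLen i : ℤ) - ((i : ℤ) + 1) + r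
      = (mu.rowLen i : ℤ) - ((i : ℤ) + 1) + r' := fun i => congrFun h3 i
  obtain ⟨N, hN⟩ := rowLen_eventually_zero la
  obtain ⟨N', hN'⟩ := rowLen_eventually_zero mu
  have hr : r = r' := by
    have a := h4 (max N N')
    rw [hN _ (le_max_left _ _), hN' _ (le_max_right _ _)] at a
    omega
  refine ⟨hr, ?_⟩
  have h5 : ∀ i, la.rowLen i = mu.rowLen i := fun i => by
    have := h4 i
    omega
  ext ⟨i, j⟩
  rw [YoungDiagram.mem_cells, YoungDiagram.mem_cells, YoungDiagram.mem_iff_lt_rowLen,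
    YoungDiagram.mem_iff_lt_rowLen, h5]

theorem betaSet_bddAbove (r : ℤ) (la : YoungDiagram) : BddAbove (betaSet r la) := by
  refine ⟨la.rowLen 0 + r, ?_⟩
  rintro _ ⟨i, rfl⟩
  have := la.rowLen_anti 0 i (Nat.zero_le i)
  show (la.rowLen i : ℤ) - ((i : ℤ) + 1) + r ≤ _
  omega

theorem betaSet_compl_bddBelow (r : ℤ) (la : YoungDiagram) : BddBelow (betaSet r la)ᶜ := by
  obtain ⟨N, hN⟩ := rowLen_eventually_zero la
  refine ⟨r - N, fun x hx => ?_⟩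
  by_contra hc
  refine hx ⟨(r - 1 - x).toNat, ?_⟩
  have h1 := hN (r - 1 - x).toNat (by omega)
  show (la.rowLen (r - 1 - x).toNat : ℤ) - (((r - 1 - x).toNat : ℤ) + 1) + r = x
  omega

/-- Every set of integers which is bounded above and whose complement is bounded below is a
beta-set. -/
theorem exists_betaSet_eq (B : Set ℤ) (h1 : BddAbove B) (h2 : BddBelow Bᶜ) :
    ∃ (la : YoungDiagram) (r : ℤ), betaSet r la = B := by
  classical
  obtain ⟨M, hM⟩ := h1
  obtain ⟨L, hL⟩ := h2
  have hLB : ∀ x, x < L → x ∈ B := fun x hx => by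
    by_contra hc
    exact absurd (hL hc) (by omega)
  let p : ℕ → Prop := fun n => M - n ∈ B
  let N : ℕ := (M - L + 1).toNat
  have hp : ∀ n, N ≤ n → p n := fun n hn => hLB _ (by omega)
  have hinf : (Set.ofPred p).Infinite :=
    Set.infinite_of_forall_exists_gt fun a => ⟨max N (a + 1), hp _ (le_max_left _ _), by
      have := le_max_right N (a + 1)
      omega⟩
  have hmono : StrictMono (Nat.nth p) := Nat.nth_strictMono hinf
  have hcount : ∀ k, Nat.count p (N + k) = Nat.count p N + k := by
    intro k
    induction k with
    | zero => rfl
    | succ k ih =>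
      rw [← Nat.add_assoc, Nat.count_succ, if_pos (hp _ (by omega)), ih]
      omega
  let C : ℕ := Nat.count p N
  have hCN : C ≤ N := Nat.count_le p
  have htail : ∀ i, C ≤ i → Nat.nth p i = N - C + i := by
    intro i hi
    have e : i = Nat.count p (N + (i - C)) := by rw [hcount]; omega
    have e2 : Nat.nth p (Nat.count p (N + (i - C))) = N + (i - C) :=
      Nat.nth_count (hp _ (by omega))
    rw [← e] at e2
    omega
  have hstep : ∀ i j, i ≤ j → Nat.nth p i + (j - i) ≤ Nat.nth p j := by
    intro i j hij
    induction j, hij using Nat.le_induction with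
    | base => simp
    | succ j hj ih =>
      have := hmono (Nat.lt_add_one j)
      omega
  have hle : ∀ i, Nat.nth p i ≤ N - C + i := by
    intro i
    by_cases hi : C ≤ i
    · exact (htail i hi).le
    · have a := hstep i C (by omega)
      have b := htail C le_rfl
      omega
  obtain ⟨la, hla⟩ := exists_youngDiagram_rowLen (fun i => N - C + i - Nat.nth p i)
    (by
      intro i j hij
      have a := hstep i j hij
      have b := hle i
      have c := hle j
      show N - C + j - Nat.nth p j ≤ N - C + i - Nat.nth p i
      omega) C (fun i hi => by have := htail i hi; show _ - _ = 0; omega)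
  refine ⟨la, M - (N - C : ℕ) + 1, ?_⟩
  have hval : ∀ i : ℕ, (la.rowLen i : ℤ) - ((i : ℤ) + 1) + (M - (N - C : ℕ) + 1)
      = M - Nat.nth p i := by
    intro i
    have a := hla i
    have b := hle i
    omega
  ext x
  constructor
  · rintro ⟨i, rfl⟩
    have : p (Nat.nth p i) := Nat.nth_mem_of_infinite hinf i
    show (la.rowLen i : ℤ) - ((i : ℤ) + 1) + (M - (N - C : ℕ) + 1) ∈ B
    rw [hval]
    exact this
  · intro hx
    have hxM := hM hx
    have hpx : p (M - x).toNat := by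
      show M - ((M - x).toNat : ℤ) ∈ B
      have : M - ((M - x).toNat : ℤ) = x := by omega
      rwa [this]
    refine ⟨Nat.count p (M - x).toNat, ?_⟩
    show (la.rowLen (Nat.count p (M - x).toNat) : ℤ) -
      ((Nat.count p (M - x).toNat : ℤ) + 1) + (M - (N - C : ℕ) + 1) = x
    rw [hval, Nat.nth_count hpx]
    omega

/-! ### Rim hooks and cores -/

/-- The rim of a partition: the nodes `(i, j)` with `(i + 1, j + 1)` not a node. -/
def rim (la : YoungDiagram) : Finset (ℕ × ℕ) :=
  la.cells.filter fun c => (c.1 + 1, c.2 + 1) ∉ la.cells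

/-- Two nodes sharing an edge. -/
def NodeAdj (a b : ℕ × ℕ) : Prop :=
  (a.1 = b.1 ∧ (a.2 + 1 = b.2 ∨ b.2 + 1 = a.2)) ∨ (a.2 = b.2 ∧ (a.1 + 1 = b.1 ∨ b.1 + 1 = a.1))

/-- Any two nodes of `H` are joined by a path of adjacent nodes inside `H`. -/
def NodesConnected (H : Finset (ℕ × ℕ)) : Prop :=
  ∀ x ∈ H, ∀ y ∈ H, Relation.ReflTransGen (fun a b => a ∈ H ∧ b ∈ H ∧ NodeAdj a b) x y

/-- `nu` is obtained from `la` by removing a rim `s`-hook, that is, a connected set of exactly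
`s` nodes of the rim whose removal leaves the Young diagram of a partition. -/
def RemovesRimHook (s : ℕ) (la nu : YoungDiagram) : Prop :=
  ∃ H : Finset (ℕ × ℕ), H ⊆ rim la ∧ H.card = s ∧ NodesConnected H ∧ nu.cells = la.cells \ H

/-- `sigma` is obtained from `la` by repeatedly removing rim `s`-hooks until none remain. -/
def IsCoreOf (s : ℕ) (la sigma : YoungDiagram) : Prop :=
  Relation.ReflTransGen (RemovesRimHook s) la sigma ∧ ∀ nu, ¬ RemovesRimHook s sigma nu

theorem exists_isCoreOf (s : ℕ) [NeZero s] (la : YoungDiagram) : ∃ sigma, IsCoreOf s la sigma := by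
  induction hn : la.card using Nat.strong_induction_on generalizing la with
  | _ n ih =>
    by_cases h : ∃ nu, RemovesRimHook s la nu
    · obtain ⟨nu, hnu⟩ := h
      have hlt : nu.card < n := by
        obtain ⟨H, hH, hc, -, he⟩ := hnu
        have hsub : H ⊆ la.cells := hH.trans (Finset.filter_subset _ _)
        have h1 : nu.cells.card = la.cells.card - H.card := by
          rw [he, Finset.card_sdiff_of_subset hsub]
        have h2 := Finset.card_le_card hsub
        have h3 := NeZero.pos s
        change nu.cells.card < n
        change la.cells.card = n at hn
        omega
      obtain ⟨sigma, h1, h2⟩ := ih _ hlt nu rfl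
      exact ⟨sigma, Relation.ReflTransGen.head hnu h1, h2⟩
    · exact ⟨la, Relation.ReflTransGen.refl, fun nu hnu => h ⟨nu, hnu⟩⟩

/-- The `s`-core of `la`. (The result of the removal process does not depend on choices.) -/
noncomputable def core (s : ℕ) [NeZero s] (la : YoungDiagram) : YoungDiagram :=
  Classical.choose (exists_isCoreOf s la)

/-! ### The `s`-set, the `s`-quotient and the `t`-weighted `s`-quotient -/

/-- The element of the `s`-set of `la` in the residue class `i`: the smallest integer in the
class `i` that is not in the beta-set (of charge `0`) of the `s`-core of `la`. -/
noncomputable def sSetElt (s : ℕ) [NeZero s] (la : YoungDiagram) (i : ZMod s) : ℤ :=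
  sInf {n : ℤ | (n : ZMod s) = i ∧ n ∉ betaSet 0 (core s la)}

/-- The minimum in the definition of `sSetElt` exists. -/
theorem sSetElt_isLeast (s : ℕ) [NeZero s] (la : YoungDiagram) (i : ZMod s) :
    IsLeast {n : ℤ | (n : ZMod s) = i ∧ n ∉ betaSet 0 (core s la)} (sSetElt s la i) := by
  have hb : BddBelow {n : ℤ | (n : ZMod s) = i ∧ n ∉ betaSet 0 (core s la)} :=
    (betaSet_compl_bddBelow 0 (core s la)).mono fun n hn => hn.2
  have hne : {n : ℤ | (n : ZMod s) = i ∧ n ∉ betaSet 0 (core s la)}.Nonempty := by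
    obtain ⟨M, hM⟩ := betaSet_bddAbove 0 (core s la)
    refine ⟨(i.val : ℤ) + s * (|M| + 1), by simp, fun hmem => ?_⟩
    have h1 := hM hmem
    have h2 : (1 : ℤ) ≤ s := by exact_mod_cast NeZero.one_le
    have h3 := le_abs_self M
    have h4 := abs_nonneg M
    nlinarith
  exact ⟨Int.csInf_mem hne hb, fun n hn => csInf_le hb hn⟩

theorem exists_quotientPart (s : ℕ) [NeZero s] (la : YoungDiagram) (i : ZMod s) :
    ∃ (nu : YoungDiagram) (r : ℤ),
      betaSet r nu = {m : ℤ | (i.val : ℤ) + s * m ∈ betaSet 0 la} := by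
  have h2 : (1 : ℤ) ≤ s := by exact_mod_cast NeZero.one_le
  have h0 : (0 : ℤ) ≤ (i.val : ℤ) := Int.natCast_nonneg _
  have h1 : (i.val : ℤ) < s := by exact_mod_cast ZMod.val_lt i
  apply exists_betaSet_eq
  · obtain ⟨M, hM⟩ := betaSet_bddAbove 0 la
    refine ⟨|M|, fun m hm => ?_⟩
    have a := hM hm
    have b := le_abs_self M
    have c := abs_nonneg M
    by_contra hc
    nlinarith
  · obtain ⟨L, hL⟩ := betaSet_compl_bddBelow 0 la
    refine ⟨-|L| - 1, fun m hm => ?_⟩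
    have a := hL hm
    have b := neg_abs_le L
    have c := abs_nonneg L
    by_contra hc
    nlinarith

/-- The component of the `s`-quotient of `la` in the residue class `i`: the partition which has
(for some charge) the beta-set obtained from the elements of the class `i` in the beta-set of `la`
by subtracting a representative of `i` and dividing by `s`. -/
noncomputable def quotientPart (s : ℕ) [NeZero s] (la : YoungDiagram) (i : ZMod s) :
    YoungDiagram :=
  Classical.choose (exists_quotientPart s la i)

/-- The `t`-weighted `s`-quotient of `la`. -/
noncomputable def weightedQuotient (s t : ℕ) [NeZero s] (la : YoungDiagram) :
    Multiset (ZMod t × YoungDiagram) :=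
  (Finset.univ : Finset (ZMod s)).val.map fun i =>
    ((sSetElt s la i : ZMod t), quotientPart s la i)

/-! ### The Coxeter group of type affine `A_{s-1}` and its level `t` action -/

/-- The Coxeter matrix of type affine `A_{s-1}` (for `s ≥ 2`), with nodes indexed by `ℤ/sℤ`. In
the case `s = 2` the two generators satisfy no braid relation (the entry `0` stands for `∞`). -/
def affineMatrix (s : ℕ) : CoxeterMatrix (ZMod s) where
  M := Matrix.of fun i j =>
    if i = j then 1 else if s = 2 then 0 else if j = i + 1 ∨ i = j + 1 then 3 else 2
  isSymm := by
    ext i j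
    simp only [Matrix.transpose_apply, Matrix.of_apply, eq_comm (a := j) (b := i),
      or_comm (a := i = j + 1)]
  diagonal := by simp
  off_diagonal := by
    intro i j h
    simp only [Matrix.of_apply, if_neg h]
    split_ifs <;> simp

/-- The Coxeter group of type affine `A_{s-1}`. -/
abbrev AffineSymm (s : ℕ) : Type := (affineMatrix s).Group

/-- The generator `w_i`, `i ∈ ℤ/sℤ`, acting on the integers at level `t`: with
`c = (s - 1) (t - 1) / 2`, it adds `t` to the integers in the class `(i - 1) t - c`, subtracts `t`
from those in the class `i t - c`, and fixes all others. -/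
def levelFun (s t : ℕ) (i : ZMod s) (n : ℤ) : ℤ :=
  if (n : ZMod s) = (i - 1) * t - ((((s : ℤ) - 1) * ((t : ℤ) - 1) / 2 : ℤ) : ZMod s) then n + t
  else if (n : ZMod s) = i * t - ((((s : ℤ) - 1) * ((t : ℤ) - 1) / 2 : ℤ) : ZMod s) then n - t
  else n

theorem levelFun_index (s t : ℕ) (hst : s.Coprime t) : ∃ idx : ℤ → ZMod s,
    (∀ n, idx (n + t) = idx n + 1) ∧ (∀ n, idx (n - t) = idx n - 1) ∧
    ∀ i n, levelFun s t i n =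
      if idx n = i - 1 then n + t else if idx n = i then n - t else n := by
  have hT : (t : ZMod s) * (t : ZMod s)⁻¹ = 1 := ZMod.coe_mul_inv_eq_one t hst.symm
  generalize hc : ((((s : ℤ) - 1) * ((t : ℤ) - 1) / 2 : ℤ) : ZMod s) = c
  refine ⟨fun n => ((n : ZMod s) + c) * (t : ZMod s)⁻¹, fun n => ?_, fun n => ?_, fun i n => ?_⟩
  · push_cast
    linear_combination hT
  · push_cast
    linear_combination -hT
  · have key : ∀ k : ZMod s, (n : ZMod s) = k * t - c ↔ ((n : ZMod s) + c) * (t : ZMod s)⁻¹ = k := by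
      intro k
      constructor
      · intro h
        rw [h]
        linear_combination k * hT
      · intro h
        rw [← h]
        linear_combination (-(n : ZMod s) - c) * hT
    simp only [levelFun, hc, key]

theorem zmod_one_ne_zero {s : ℕ} (hs : 2 ≤ s) : (1 : ZMod s) ≠ 0 := by
  have : Fact (1 < s) := ⟨hs⟩
  exact one_ne_zero

theorem levelFun_invol {s t : ℕ} (hs : 2 ≤ s) (hst : s.Coprime t) (i : ZMod s) (n : ℤ) :
    levelFun s t i (levelFun s t i n) = n := by
  obtain ⟨idx, h1, h2, h3⟩ := levelFun_index s t hst
  have h := zmod_one_ne_zero hs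
  simp only [h3]
  grind

/-- The generator `w_i` at level `t` as a permutation of the integers. -/
def levelGen (s t : ℕ) (hs : 2 ≤ s) (hst : s.Coprime t) (i : ZMod s) : Equiv.Perm ℤ where
  toFun := levelFun s t i
  invFun := levelFun s t i
  left_inv := levelFun_invol hs hst i
  right_inv := levelFun_invol hs hst i

theorem levelGen_mul_self (s t : ℕ) (hs : 2 ≤ s) (hst : s.Coprime t) (i : ZMod s) :
    levelGen s t hs hst i * levelGen s t hs hst i = 1 :=
  Equiv.ext fun n => levelFun_invol hs hst i n

theorem levelGen_comm (s t : ℕ) (hs : 2 ≤ s) (hst : s.Coprime t) (i j : ZMod s)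
    (h1 : j ≠ i + 1) (h2 : i ≠ j + 1) :
    levelGen s t hs hst i * levelGen s t hs hst j
      = levelGen s t hs hst j * levelGen s t hs hst i := by
  obtain ⟨idx, e1, e2, e3⟩ := levelFun_index s t hst
  have h := zmod_one_ne_zero hs
  ext n
  show levelFun s t i (levelFun s t j n) = levelFun s t j (levelFun s t i n)
  simp only [e3]
  grind

theorem levelGen_braid (s t : ℕ) (hs : 2 ≤ s) (hst : s.Coprime t) (hs2 : s ≠ 2) (i : ZMod s) :
    levelGen s t hs hst i * levelGen s t hs hst (i + 1) * levelGen s t hs hst i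
      = levelGen s t hs hst (i + 1) * levelGen s t hs hst i * levelGen s t hs hst (i + 1) := by
  obtain ⟨idx, e1, e2, e3⟩ := levelFun_index s t hst
  have h := zmod_one_ne_zero hs
  have h' : (2 : ZMod s) ≠ 0 := by
    intro hc
    have : ((2 : ℕ) : ZMod s) = 0 := by exact_mod_cast hc
    have := Nat.le_of_dvd (by norm_num) ((ZMod.natCast_eq_zero_iff 2 s).1 this)
    omega
  ext n
  show levelFun s t i (levelFun s t (i + 1) (levelFun s t i n))
    = levelFun s t (i + 1) (levelFun s t i (levelFun s t (i + 1) n))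
  simp only [e3]
  grind

theorem levelGen_isLiftable (s t : ℕ) (hs : 2 ≤ s) (hst : s.Coprime t) :
    (affineMatrix s).IsLiftable (levelGen s t hs hst) := by
  have sq := levelGen_mul_self s t hs hst
  have cube : ∀ a b : Equiv.Perm ℤ, a * a = 1 → b * b = 1 → a * b * a = b * a * b →
      (a * b) ^ 3 = 1 := by
    intro a b ha hb hab
    calc (a * b) ^ 3 = (a * b * a) * (b * a * b) := by simp only [pow_succ, pow_zero, one_mul, mul_assoc]
      _ = (a * b * a) * (a * b * a) := by rw [hab]
      _ = a * b * (a * a) * b * a := by simp only [mul_assoc]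
      _ = a * (b * b) * a := by rw [ha]; simp only [mul_assoc, one_mul]
      _ = 1 := by rw [hb, mul_one, ha]
  intro i j
  show _ ^ (if i = j then 1 else if s = 2 then 0 else if j = i + 1 ∨ i = j + 1 then 3 else 2) = _
  by_cases hij : i = j
  · subst hij
    simp [sq]
  by_cases hs2 : s = 2
  · simp [hij, hs2]
  rw [if_neg hij, if_neg hs2]
  by_cases h1 : j = i + 1
  · subst h1
    rw [if_pos (Or.inl rfl)]
    exact cube _ _ (sq _) (sq _) (levelGen_braid s t hs hst hs2 i)
  by_cases h2 : i = j + 1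
  · subst h2
    rw [if_pos (Or.inr rfl)]
    exact cube _ _ (sq _) (sq _) (levelGen_braid s t hs hst hs2 j).symm
  rw [if_neg (by tauto), pow_two]
  calc _ = levelGen s t hs hst i * (levelGen s t hs hst j * levelGen s t hs hst i)
          * levelGen s t hs hst j := by simp only [mul_assoc]
    _ = (levelGen s t hs hst i * levelGen s t hs hst i)
          * (levelGen s t hs hst j * levelGen s t hs hst j) := by
        rw [← levelGen_comm s t hs hst i j h1 h2]; simp only [mul_assoc]
    _ = 1 := by rw [sq, sq, one_mul]

/-- The level `t` action of the Coxeter group on the integers. -/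
noncomputable def levelInt (s t : ℕ) (hs : 2 ≤ s) (hst : s.Coprime t) :
    AffineSymm s →* Equiv.Perm ℤ :=
  (affineMatrix s).toCoxeterSystem.lift ⟨levelGen s t hs hst, levelGen_isLiftable s t hs hst⟩

theorem levelInt_simple (s t : ℕ) (hs : 2 ≤ s) (hst : s.Coprime t) (i : ZMod s) :
    levelInt s t hs hst ((affineMatrix s).simple i) = levelGen s t hs hst i := by
  rw [← CoxeterMatrix.toCoxeterSystem_simple]
  exact CoxeterSystem.lift_apply_simple _ _ i

/-- The number of elements of a beta-set above a low enough bound determines the charge. -/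
theorem betaSet_ncard (r : ℤ) (la : YoungDiagram) : ∃ K : ℤ, ∀ N : ℤ, K ≤ N →
    ((betaSet r la ∩ Set.Ici (-N)).ncard : ℤ) = N + r := by
  obtain ⟨N₀, hN₀⟩ := rowLen_eventually_zero la
  refine ⟨N₀ + |r|, fun N hN => ?_⟩
  have hr := neg_abs_le r
  have hset : betaSet r la ∩ Set.Ici (-N) =
      (fun i : ℕ => (la.rowLen i : ℤ) - ((i : ℤ) + 1) + r) '' ↑(Finset.range (N + r).toNat) := by
    ext x
    constructor
    · rintro ⟨⟨i, rfl⟩, hi⟩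
      refine ⟨i, ?_, rfl⟩
      simp only [Set.mem_Ici] at hi
      simp only [Finset.coe_range, Set.mem_Iio]
      by_cases hiN : N₀ ≤ i
      · have := hN₀ i hiN
        omega
      · omega
    · rintro ⟨i, hi, rfl⟩
      refine ⟨⟨i, rfl⟩, ?_⟩
      simp only [Finset.coe_range, Set.mem_Iio] at hi
      simp only [Set.mem_Ici]
      omega
  rw [hset, Set.ncard_image_of_injective _ (betaSet_strictAnti r la).injective,
    Set.ncard_coe_finset, Finset.card_range]
  omega

theorem levelGen_betaSet (s t : ℕ) (hs : 2 ≤ s) (hst : s.Coprime t) (i : ZMod s)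
    (la : YoungDiagram) : ∃ mu, betaSet 0 mu = levelGen s t hs hst i '' betaSet 0 la := by
  have hone := zmod_one_ne_zero hs
  have hmv : ∀ n, levelFun s t i n ≤ n + t ∧ n - t ≤ levelFun s t i n := by
    intro n
    unfold levelFun
    split_ifs <;> omega
  have hinv := levelFun_invol hs hst i
  have hab : BddAbove (levelGen s t hs hst i '' betaSet 0 la) := by
    obtain ⟨M, hM⟩ := betaSet_bddAbove 0 la
    refine ⟨M + t, ?_⟩
    rintro _ ⟨n, hn, rfl⟩
    have a := hM hn
    have b := (hmv n).1
    show levelFun s t i n ≤ _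
    omega
  have hbb : BddBelow (levelGen s t hs hst i '' betaSet 0 la)ᶜ := by
    obtain ⟨L, hL⟩ := betaSet_compl_bddBelow 0 la
    refine ⟨L - t, fun x hx => ?_⟩
    have a : levelFun s t i x ∈ (betaSet 0 la)ᶜ := fun hc => hx ⟨_, hc, hinv x⟩
    have b := hL a
    have c := (hmv x).1
    omega
  obtain ⟨mu, r, hmu⟩ := exists_betaSet_eq _ hab hbb
  suffices hr : r = 0 by
    subst hr
    exact ⟨mu, hmu⟩
  obtain ⟨K₁, hK₁⟩ := betaSet_ncard 0 la
  obtain ⟨K₂, hK₂⟩ := betaSet_ncard r mu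
  obtain ⟨L₁, hL₁⟩ := betaSet_compl_bddBelow 0 la
  obtain ⟨L₂, hL₂⟩ := betaSet_compl_bddBelow r mu
  obtain ⟨N, n1, n2, n3, n4⟩ : ∃ N : ℤ, K₁ ≤ N ∧ K₂ ≤ N ∧ -N ≤ L₁ ∧ -N ≤ L₂ :=
    ⟨|K₁| + |K₂| + |L₁| + |L₂|, by
      have := le_abs_self K₁; have := le_abs_self K₂; have := neg_abs_le L₁
      have := neg_abs_le L₂; have := abs_nonneg K₁; have := abs_nonneg K₂
      have := abs_nonneg L₁; have := abs_nonneg L₂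
      omega⟩
  obtain ⟨idx, e1, e2, e3⟩ := levelFun_index s t hst
  -- a set of integers stable under the generator that differs little from a half-line
  let D : Set ℤ := {n | n < -N ∧ -N ≤ n + t ∧ idx n = i - 1}
  have hDfin : D.Finite := (Set.finite_Ico (-N - t) (-N)).subset fun n hn => by
    obtain ⟨a, b, -⟩ := hn
    simp only [Set.mem_Ico]
    omega
  have hsplit : ∀ (q : ℤ) (nu : YoungDiagram) (L : ℤ), L ∈ lowerBounds (betaSet q nu)ᶜ → -N ≤ L →
      ((betaSet q nu ∩ (Set.Ici (-N) ∪ D)).ncard : ℤ)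
        = (betaSet q nu ∩ Set.Ici (-N)).ncard + D.ncard := by
    intro q nu L hL hNL
    have hDsub : betaSet q nu ∩ D = D := Set.inter_eq_right.2 fun n hn => by
      by_contra hc
      have := hL hc
      have := hn.1
      omega
    obtain ⟨M, hM⟩ := betaSet_bddAbove q nu
    have hfin : (betaSet q nu ∩ Set.Ici (-N)).Finite :=
      (Set.finite_Icc (-N) M).subset fun n hn => ⟨hn.2, hM hn.1⟩
    rw [Set.inter_union_distrib_left, hDsub, Set.ncard_union_eq _ hfin hDfin]
    · push_cast; rfl
    · rw [Set.disjoint_left]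
      rintro n ⟨-, h1⟩ ⟨h2, -⟩
      simp only [Set.mem_Ici] at h1
      omega
  have hstab : ∀ n, n ∈ Set.Ici (-N) ∪ D → levelFun s t i n ∈ Set.Ici (-N) ∪ D := by
    intro n hn
    have hnt : (0 : ℤ) ≤ t := Int.natCast_nonneg t
    simp only [Set.mem_union, Set.mem_Ici, D, Set.mem_ofPred_eq] at hn ⊢
    rw [e3]
    split_ifs with c1 c2
    · left
      rcases hn with h | h <;> omega
    · have d := e2 n
      rw [c2] at d
      have hne : i ≠ i - 1 := fun hc => hone (by linear_combination hc)
      have hn' : -N ≤ n := by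
        rcases hn with h | h
        · exact h
        · exact absurd (c2.symm.trans h.2.2) hne
      by_cases hlt : n - t < -N
      · right
        exact ⟨hlt, by omega, d⟩
      · left
        omega
    · exact hn
  have himg : levelGen s t hs hst i '' (betaSet 0 la ∩ (Set.Ici (-N) ∪ D))
      = betaSet r mu ∩ (Set.Ici (-N) ∪ D) := by
    rw [hmu]
    ext x
    constructor
    · rintro ⟨n, ⟨h1, h2⟩, rfl⟩
      exact ⟨⟨n, h1, rfl⟩, hstab n h2⟩
    · rintro ⟨⟨n, h1, rfl⟩, h2⟩
      refine ⟨n, ⟨h1, ?_⟩, rfl⟩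
      have := hstab _ h2
      rwa [show levelFun s t i (levelGen s t hs hst i n) = n from hinv n] at this
  have hcard := Set.ncard_image_of_injective (betaSet 0 la ∩ (Set.Ici (-N) ∪ D))
    (levelGen s t hs hst i).injective
  rw [himg] at hcard
  have f1 := hsplit 0 la L₁ hL₁ n3
  have f2 := hsplit r mu L₂ hL₂ n4
  have f3 := hK₁ N n1
  have f4 := hK₂ N n2
  omega

theorem levelInt_betaSet (s t : ℕ) (hs : 2 ≤ s) (hst : s.Coprime t) (w : AffineSymm s) :
    ∀ la : YoungDiagram, ∃ mu, betaSet 0 mu = levelInt s t hs hst w '' betaSet 0 la := by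
  induction w using (affineMatrix s).toCoxeterSystem.simple_induction with
  | simple i =>
    intro la
    rw [CoxeterMatrix.toCoxeterSystem_simple, levelInt_simple]
    exact levelGen_betaSet s t hs hst i la
  | one => exact fun la => ⟨la, by simp⟩
  | mul w w' h h' =>
    intro la
    obtain ⟨mu, hmu⟩ := h' la
    obtain ⟨nu, hnu⟩ := h mu
    refine ⟨nu, ?_⟩
    rw [hnu, hmu, map_mul, Equiv.Perm.coe_mul, Set.image_comp]

/-- The image of a partition under a group element at level `t`: the partition whose beta-set is
the image of the beta-set. -/
noncomputable def levelSMul (s t : ℕ) (hs : 2 ≤ s) (hst : s.Coprime t) (w : AffineSymm s)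
    (la : YoungDiagram) : YoungDiagram :=
  Classical.choose (levelInt_betaSet s t hs hst w la)

theorem betaSet_levelSMul (s t : ℕ) (hs : 2 ≤ s) (hst : s.Coprime t) (w : AffineSymm s)
    (la : YoungDiagram) :
    betaSet 0 (levelSMul s t hs hst w la) = levelInt s t hs hst w '' betaSet 0 la :=
  Classical.choose_spec (levelInt_betaSet s t hs hst w la)

/-- The level `t` action of the Coxeter group on partitions. -/
@[reducible]
noncomputable def levelAction (s t : ℕ) (hs : 2 ≤ s) (hst : s.Coprime t) :
    MulAction (AffineSymm s) YoungDiagram where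
  smul := levelSMul s t hs hst
  one_smul la := by
    refine (betaSet_inj (r := 0) (r' := 0) ?_).2
    refine (betaSet_levelSMul s t hs hst 1 la).trans ?_
    simp
  mul_smul w w' la := by
    refine (betaSet_inj (r := 0) (r' := 0) ?_).2
    refine (betaSet_levelSMul s t hs hst (w * w') la).trans ?_
    refine Eq.trans ?_ (betaSet_levelSMul s t hs hst w (levelSMul s t hs hst w' la)).symm
    rw [betaSet_levelSMul, map_mul, Equiv.Perm.coe_mul, Set.image_comp]

/-- The level `t` orbit of a partition. -/
noncomputable def levelOrbit (s t : ℕ) (hs : 2 ≤ s) (hst : s.Coprime t) (la : YoungDiagram) :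
    Set YoungDiagram :=
  letI := levelAction s t hs hst
  MulAction.orbit (AffineSymm s) la

/-! Picture `betaSet 0 la` as beads on `s` runners, the residue classes modulo `s`. On each runner
the beads form a beta-set of the quotient component `quotientPart s la i`, with some charge.
Removing a rim `s`-hook moves a bead from `b` to the empty place `b - s`, which stays on its runner
and keeps the runner's charge. In the core no bead can move, so every runner is a half-line ending
at its charge; hence `sSetElt s la i` records the charge of runner `i` in `la` itself. This gives
`sSetElt_add_mem_betaSet`: the place `e_i + s m` is occupied iff `m` lies in the charge `0` beta-set
of the `i`-th quotient component.

Each element `w` of the group commutes with translation by `s` and preserves residues modulo `t`. It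
therefore carries the runner based at `e_i` to the runner based at `w e_i` with the same component
and the same weight modulo `t`, so the weighted quotient is constant on orbits.

Conversely, equal weighted quotients give a matching under which the two `s`-sets differ by
multiples `t d_j`. In `exists_levelInt_add_eq` the generators sort these `d_j`, decreasing the sum
of squares, until all are equal. The remaining common shift must be `0`, because both beta-sets have
charge `0`.

The dictionary between rim hooks and bead moves goes through diagonal lengths: their discrete
derivative is the beta-set, up to the half-line of the empty partition, and a rim hook shortens an
interval of diagonals by one node each. -/

/-! ### Diagonals of a Young diagram -/

/-- The number of nodes of content `c`, that is, of nodes `(i, j)` with `j - i = c`. -/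
def diagLen (la : YoungDiagram) (c : ℤ) : ℕ :=
  (la.cells.filter fun x => (x.2 : ℤ) - x.1 = c).card

/-- Number the places of a diagonal by `min i j`. Moving up-left stays in the diagram, so the
numbers of its nodes form an initial segment of `ℕ`. -/
theorem mem_iff_lt_diagLen (la : YoungDiagram) (i j : ℕ) :
    (i, j) ∈ la ↔ min i j < diagLen la ((j : ℤ) - i) := by
  classical
  let S := la.cells.filter fun x => (x.2 : ℤ) - x.1 = (j : ℤ) - i
  have hinj : Set.InjOn (fun x : ℕ × ℕ => min x.1 x.2) (S : Set (ℕ × ℕ)) := by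
    rintro ⟨a, b⟩ hab ⟨c, d⟩ hcd h
    have h1 := (Finset.mem_filter.1 (Finset.mem_coe.1 hab)).2
    have h2 := (Finset.mem_filter.1 (Finset.mem_coe.1 hcd)).2
    simp only at h h1 h2
    ext <;> simp only <;> omega
  have hcard : (S.image fun x => min x.1 x.2).card = diagLen la ((j : ℤ) - i) :=
    Finset.card_image_of_injOn hinj
  -- The subtractions are truncated: one of `i - j`, `j - i` is `0`, so this is place `k` on the
  -- diagonal through `(i, j)`.
  have hmem : ∀ k, k ∈ S.image (fun x => min x.1 x.2) ↔ (k + (i - j), k + (j - i)) ∈ la := by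
    intro k
    simp only [S, Finset.mem_image, Finset.mem_filter, Prod.exists]
    constructor
    · rintro ⟨a, b, ⟨h1, h2⟩, h3⟩
      have ha : a = k + (i - j) := by omega
      have hb : b = k + (j - i) := by omega
      subst ha hb
      exact h1
    · intro h
      exact ⟨_, _, ⟨h, by omega⟩, by omega⟩
  have hij : (i, j) = (min i j + (i - j), min i j + (j - i)) := by
    ext <;> simp only <;> omega
  have hlow : ∀ k l, k ≤ l → l ∈ S.image (fun x => min x.1 x.2) →
      k ∈ S.image (fun x => min x.1 x.2) := by
    intro k l hkl hl
    rw [hmem] at hl ⊢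
    exact la.up_left_mem (by omega) (by omega) hl
  rw [hij, ← hmem, ← hcard]
  constructor
  · intro h
    have : Finset.range (min i j + 1) ⊆ S.image fun x => min x.1 x.2 := fun k hk =>
      hlow k _ (by have := Finset.mem_range.1 hk; omega) h
    have := Finset.card_le_card this
    rw [Finset.card_range] at this
    omega
  · intro h
    by_contra hc
    have : S.image (fun x => min x.1 x.2) ⊆ Finset.range (min i j) := fun k hk => by
      rw [Finset.mem_range]
      by_contra hk'
      exact hc (hlow _ k (by omega) hk)
    have := Finset.card_le_card this
    rw [Finset.card_range] at this
    omega

/-- On or right of the main diagonal, place `k` of a diagonal lies in row `k`. One step left and one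
step up compare neighbouring diagonals. -/
theorem diagLen_succ_of_nonneg (la : YoungDiagram) {c : ℤ} (hc : 0 ≤ c) :
    diagLen la (c + 1) ≤ diagLen la c ∧ diagLen la c ≤ diagLen la (c + 1) + 1 := by
  have h := mem_iff_lt_diagLen la
  lift c to ℕ using hc
  have h0 : ∀ i : ℕ, (i, i + c) ∈ la ↔ i < diagLen la c := fun i => by
    have := h i (i + c)
    rwa [min_eq_left (by omega), show (((i + c : ℕ) : ℤ) - i) = c by omega] at this
  have h1 : ∀ i : ℕ, (i, i + c + 1) ∈ la ↔ i < diagLen la (c + 1) := fun i => by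
    have := h i (i + c + 1)
    rwa [min_eq_left (by omega), show (((i + c + 1 : ℕ) : ℤ) - i) = c + 1 by omega] at this
  constructor
  · by_contra! hlt
    exact absurd ((h0 _).1 (la.up_left_mem le_rfl (by omega) ((h1 _).2 hlt))) (lt_irrefl _)
  · by_contra! hlt
    have := (h0 _).2 hlt
    exact absurd ((h1 (diagLen la (c + 1))).1 (la.up_left_mem (by omega) (by omega) this))
      (lt_irrefl _)

theorem diagLen_succ_of_neg (la : YoungDiagram) {c : ℤ} (hc : c < 0) :
    diagLen la c ≤ diagLen la (c + 1) ∧ diagLen la (c + 1) ≤ diagLen la c + 1 := by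
  have h := mem_iff_lt_diagLen la
  obtain ⟨k, rfl⟩ : ∃ k : ℕ, c = -((k : ℤ) + 1) := ⟨(-c - 1).toNat, by omega⟩
  have h0 : ∀ j : ℕ, (j + k + 1, j) ∈ la ↔ j < diagLen la (-((k : ℤ) + 1)) := fun j => by
    have := h (j + k + 1) j
    rwa [min_eq_right (by omega),
      show ((j : ℤ) - (j + k + 1 : ℕ)) = -((k : ℤ) + 1) by omega] at this
  have h1 : ∀ j : ℕ, (j + k, j) ∈ la ↔ j < diagLen la (-((k : ℤ) + 1) + 1) := fun j => by
    have := h (j + k) j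
    rwa [min_eq_right (by omega),
      show ((j : ℤ) - (j + k : ℕ)) = -((k : ℤ) + 1) + 1 by omega] at this
  constructor
  · by_contra! hlt
    exact absurd ((h1 _).1 (la.up_left_mem (by omega) le_rfl ((h0 _).2 hlt))) (lt_irrefl _)
  · by_contra! hlt
    have := (h1 _).2 hlt
    exact absurd ((h0 (diagLen la (-((k : ℤ) + 1)))).1
      (la.up_left_mem (by omega) (by omega) this)) (lt_irrefl _)

/-- Here `j` is the length of row `i`. Its end is expressed by membership of nodes so that it can be
tested on the diagonals `b` and `b + 1`. -/
theorem mem_betaSet_zero_iff (la : YoungDiagram) (b : ℤ) :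
    b ∈ betaSet 0 la ↔ ∃ i j : ℕ, (j : ℤ) = b + i + 1 ∧ (i, j) ∉ la ∧ ∀ k < j, (i, k) ∈ la := by
  constructor
  · rintro ⟨i, rfl⟩
    refine ⟨i, la.rowLen i, by simp only; omega, ?_, fun k hk => ?_⟩
    · rw [YoungDiagram.mem_iff_lt_rowLen]
      exact lt_irrefl _
    · exact YoungDiagram.mem_iff_lt_rowLen.2 hk
  · rintro ⟨i, j, h1, h2, h3⟩
    have : la.rowLen i = j := by
      rw [YoungDiagram.mem_iff_lt_rowLen] at h2
      by_contra hne
      exact lt_irrefl _ (YoungDiagram.mem_iff_lt_rowLen.1 (h3 (la.rowLen i) (by omega)))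
    exact ⟨i, by simp only; omega⟩

open Classical in
/-- The beta-set as the discrete derivative of the diagonal lengths. -/
theorem indicator_betaSet_zero (la : YoungDiagram) (b : ℤ) :
    (if b ∈ betaSet 0 la then 1 else 0 : ℤ)
      = diagLen la b - diagLen la (b + 1) + if b < 0 then 1 else 0 := by
  have h := mem_iff_lt_diagLen la
  have hmem := mem_betaSet_zero_iff la b
  by_cases hb : b < 0
  · obtain ⟨a1, a2⟩ := diagLen_succ_of_neg la hb
    have key : b ∈ betaSet 0 la ↔ diagLen la (b + 1) ≤ diagLen la b := by
      rw [hmem]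
      constructor
      · rintro ⟨i, j, h1, h2, h3⟩
        rw [h, min_eq_right (by omega), show (j : ℤ) - i = b + 1 by omega] at h2
        rcases Nat.eq_zero_or_pos j with h0 | h0
        · omega
        · have := h3 (j - 1) (by omega)
          rw [h, min_eq_right (by omega), show ((j - 1 : ℕ) : ℤ) - i = b by omega] at this
          omega
      · intro hle
        -- The row through the last node of the diagonal `b`; if that diagonal is empty, this is the
        -- empty row `-b - 1`.
        refine ⟨(diagLen la b - b - 1).toNat, diagLen la b, by omega, ?_, fun k hk => ?_⟩
        · rw [h, min_eq_right (by omega),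
            show (diagLen la b : ℤ) - ((diagLen la b - b - 1).toNat : ℕ) = b + 1 by omega]
          omega
        · refine la.up_left_mem (i2 := (diagLen la b - b - 1).toNat) (j2 := diagLen la b - 1)
            le_rfl (by omega) ?_
          rw [h, min_eq_right (by omega), show ((diagLen la b - 1 : ℕ) : ℤ)
            - ((diagLen la b - b - 1).toNat : ℕ) = b by omega]
          omega
    rw [if_pos hb]
    split_ifs with hB
    · have := key.1 hB
      omega
    · have := mt key.2 hB
      omega
  · obtain ⟨a1, a2⟩ := diagLen_succ_of_nonneg la (not_lt.1 hb)
    have key : b ∈ betaSet 0 la ↔ diagLen la (b + 1) < diagLen la b := by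
      rw [hmem]
      constructor
      · rintro ⟨i, j, h1, h2, h3⟩
        rw [h, min_eq_left (by omega), show (j : ℤ) - i = b + 1 by omega] at h2
        have := h3 (j - 1) (by omega)
        rw [h, min_eq_left (by omega), show ((j - 1 : ℕ) : ℤ) - i = b by omega] at this
        omega
      · intro hlt
        -- Here `diagLen la b = diagLen la (b + 1) + 1`, so the row `diagLen la (b + 1)` contains
        -- the last node of the diagonal `b`.
        refine ⟨diagLen la (b + 1), (diagLen la (b + 1) + b + 1).toNat, by omega, ?_,
          fun k hk => ?_⟩
        · rw [h, min_eq_left (by omega), show (((diagLen la (b + 1) + b + 1).toNat : ℕ) : ℤ)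
            - diagLen la (b + 1) = b + 1 by omega]
          omega
        · refine la.up_left_mem (i2 := diagLen la (b + 1))
            (j2 := (diagLen la (b + 1) + b).toNat) le_rfl (by omega) ?_
          rw [h, min_eq_left (by omega), show (((diagLen la (b + 1) + b).toNat : ℕ) : ℤ)
            - diagLen la (b + 1) = b by omega]
          omega
    rw [if_neg hb]
    split_ifs with hB
    · have := key.1 hB
      omega
    · have := mt key.2 hB
      omega

theorem diagLen_eventually_zero (la : YoungDiagram) : ∃ M : ℤ, ∀ c, M ≤ c → diagLen la c = 0 := by
  refine ⟨la.rowLen 0, fun c hc => ?_⟩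
  lift c to ℕ using by omega
  have := mem_iff_lt_diagLen la 0 c
  rw [YoungDiagram.mem_iff_lt_rowLen, Nat.zero_min, Nat.cast_zero, sub_zero] at this
  omega

/-! ### Removing rim hooks, in terms of beta-sets -/

/-- Of two nodes on one diagonal, the upper has its diagonal successor in the diagram and so is not
in the rim. -/
theorem rim_content_injOn (la : YoungDiagram) :
    Set.InjOn (fun x : ℕ × ℕ => (x.2 : ℤ) - x.1) (rim la : Set (ℕ × ℕ)) := by
  have key : ∀ x ∈ rim la, ∀ y ∈ rim la, (x.2 : ℤ) - x.1 = y.2 - y.1 → y.1 ≤ x.1 := by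
    intro x hx y hy h
    by_contra! hlt
    have h1 := (Finset.mem_filter.1 hx).2
    have h2 := (Finset.mem_filter.1 hy).1
    exact h1 (la.up_left_mem (i2 := y.1) (j2 := y.2) (by omega) (by omega) h2)
  intro x hx y hy h
  have a := key x hx y hy h
  have b := key y hy x hx h.symm
  simp only at h
  ext <;> omega

/-- A discrete intermediate value theorem: adjacent nodes have contents differing by one. -/
theorem NodesConnected.exists_content {H : Finset (ℕ × ℕ)} (hH : NodesConnected H)
    {x y : ℕ × ℕ} (hx : x ∈ H) (hy : y ∈ H) {c : ℤ} (h1 : (x.2 : ℤ) - x.1 ≤ c)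
    (h2 : c ≤ (y.2 : ℤ) - y.1) : ∃ z ∈ H, (z.2 : ℤ) - z.1 = c := by
  have hpath := hH x hx y hy
  clear hy
  induction hpath with
  | refl => exact ⟨x, hx, by omega⟩
  | @tail y z _ hstep ih =>
    obtain ⟨-, hz, hadj⟩ := hstep
    by_cases hc : c ≤ (y.2 : ℤ) - y.1
    · exact ih hc
    · refine ⟨z, hz, ?_⟩
      unfold NodeAdj at hadj
      omega

theorem exists_contents_eq_interval {la : YoungDiagram} {H : Finset (ℕ × ℕ)} (hr : H ⊆ rim la)
    (hH : NodesConnected H) (h0 : 0 < H.card) :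
    ∃ p : ℤ, ∀ c, (∃ x ∈ H, (x.2 : ℤ) - x.1 = c) ↔ p ≤ c ∧ c < p + H.card := by
  classical
  have hinj : Set.InjOn (fun x : ℕ × ℕ => (x.2 : ℤ) - x.1) (H : Set (ℕ × ℕ)) :=
    (rim_content_injOn la).mono (by exact_mod_cast hr)
  have hne : H.Nonempty := Finset.card_pos.1 h0
  obtain ⟨x, hx, hmin⟩ := H.exists_min_image (fun x => (x.2 : ℤ) - x.1) hne
  obtain ⟨y, hy, hmax⟩ := H.exists_max_image (fun x => (x.2 : ℤ) - x.1) hne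
  have hC : H.image (fun x => (x.2 : ℤ) - x.1)
      = Finset.Icc ((x.2 : ℤ) - x.1) ((y.2 : ℤ) - y.1) := by
    ext c
    rw [Finset.mem_image, Finset.mem_Icc]
    constructor
    · rintro ⟨z, hz, rfl⟩
      exact ⟨hmin z hz, hmax z hz⟩
    · rintro ⟨h1, h2⟩
      exact hH.exists_content hx hy h1 h2
  have hcard := Finset.card_image_of_injOn hinj
  rw [hC, Int.card_Icc] at hcard
  refine ⟨(x.2 : ℤ) - x.1, fun c => ?_⟩
  have := Finset.ext_iff.1 hC c
  rw [Finset.mem_image, Finset.mem_Icc] at this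
  rw [this]
  clear this hne
  omega

open Classical in
theorem diagLen_of_removes {la nu : YoungDiagram} {H : Finset (ℕ × ℕ)} (hr : H ⊆ rim la)
    (he : nu.cells = la.cells \ H) (c : ℤ) :
    (diagLen la c : ℤ) = diagLen nu c + if ∃ x ∈ H, (x.2 : ℤ) - x.1 = c then 1 else 0 := by
  have hsub : H ⊆ la.cells := hr.trans (Finset.filter_subset _ _)
  have hinj : Set.InjOn (fun x : ℕ × ℕ => (x.2 : ℤ) - x.1) (H : Set (ℕ × ℕ)) :=
    (rim_content_injOn la).mono (by exact_mod_cast hr)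
  have h1 : la.cells.filter (fun x => (x.2 : ℤ) - x.1 = c)
      = nu.cells.filter (fun x => (x.2 : ℤ) - x.1 = c)
        ∪ H.filter (fun x => (x.2 : ℤ) - x.1 = c) := by
    rw [he, ← Finset.filter_union, Finset.sdiff_union_of_subset hsub]
  have h2 : Disjoint (nu.cells.filter (fun x => (x.2 : ℤ) - x.1 = c))
      (H.filter (fun x => (x.2 : ℤ) - x.1 = c)) := by
    rw [he]
    exact Finset.disjoint_filter_filter Finset.sdiff_disjoint
  have h3 : (H.filter (fun x => (x.2 : ℤ) - x.1 = c)).card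
      = if ∃ x ∈ H, (x.2 : ℤ) - x.1 = c then 1 else 0 := by
    split_ifs with h
    · obtain ⟨x, hx, hxc⟩ := h
      rw [Finset.card_eq_one]
      refine ⟨x, ?_⟩
      ext y
      rw [Finset.mem_filter, Finset.mem_singleton]
      constructor
      · rintro ⟨hy, hyc⟩
        exact hinj hy hx (hyc.trans hxc.symm)
      · rintro rfl
        exact ⟨hx, hxc⟩
    · rw [Finset.card_eq_zero, Finset.filter_eq_empty_iff]
      exact fun x hx hxc => h ⟨x, hx, hxc⟩
  unfold diagLen
  rw [h1, Finset.card_union_of_disjoint h2, h3]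
  push_cast
  rfl

/-- Removing a rim `s`-hook replaces an element `b` of the beta-set by `b - s`. -/
theorem RemovesRimHook.exists_betaSet {s : ℕ} (hs : 0 < s) {la nu : YoungDiagram}
    (h : RemovesRimHook s la nu) : ∃ b, b ∈ betaSet 0 la ∧ b - s ∉ betaSet 0 la ∧
      ∀ n, n ∈ betaSet 0 nu ↔ n = b - s ∨ n ∈ betaSet 0 la ∧ n ≠ b := by
  classical
  obtain ⟨H, hr, hcard, hconn, he⟩ := h
  obtain ⟨p, hp⟩ := exists_contents_eq_interval hr hconn (by omega)
  rw [hcard] at hp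
  have hD := diagLen_of_removes hr he
  simp only [hp] at hD
  -- The indicator of the interval of contents `[p, p + s)` has a discrete derivative supported at
  -- `p - 1` and `p + s - 1`.
  have key : ∀ n, (if n ∈ betaSet 0 nu then 1 else 0 : ℤ) = (if n ∈ betaSet 0 la then 1 else 0)
      - (if n = p + s - 1 then 1 else 0) + (if n = p - 1 then 1 else 0) := by
    intro n
    rw [indicator_betaSet_zero, indicator_betaSet_zero, hD, hD]
    split_ifs <;> omega
  refine ⟨p + s - 1, ?_, ?_, fun n => ?_⟩
  · have := key (p + s - 1)
    by_contra hb
    rw [if_neg hb, if_pos rfl, if_neg (by omega)] at this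
    split_ifs at this <;> omega
  · have := key (p - 1)
    rw [show p + s - 1 - (s : ℤ) = p - 1 by omega]
    intro hb
    rw [if_pos hb, if_neg (by omega), if_pos rfl] at this
    split_ifs at this <;> omega
  · have := key n
    rw [show p + s - 1 - (s : ℤ) = p - 1 by omega]
    split_ifs at this <;> grind

open Classical in
/-- A partition whose beta-set is that of `la` with `b` replaced by `b - s` has shorter diagonals
exactly at the contents from `b - s + 1` to `b`. -/
theorem diagLen_of_betaSet {s : ℕ} {la nu : YoungDiagram} {b : ℤ}
    (hb : b ∈ betaSet 0 la) (hbs : b - s ∉ betaSet 0 la)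
    (hn : ∀ n, n ∈ betaSet 0 nu ↔ n = b - s ∨ n ∈ betaSet 0 la ∧ n ≠ b) (c : ℤ) :
    (diagLen la c : ℤ) = diagLen nu c + if b - s < c ∧ c ≤ b then 1 else 0 := by
  have hs : (s : ℤ) ≠ 0 := fun h => hbs (by rwa [h, sub_zero])
  have step : ∀ c, (diagLen la c : ℤ) - diagLen la (c + 1) - (diagLen nu c - diagLen nu (c + 1))
      = (if c = b then 1 else 0) - (if c = b - s then 1 else 0) := by
    intro c
    have h1 := indicator_betaSet_zero la c
    have h2 := indicator_betaSet_zero nu c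
    have h3 := hn c
    have h4 : (if c ∈ betaSet 0 la then 1 else 0 : ℤ) - (if c ∈ betaSet 0 nu then 1 else 0)
        = (if c = b then 1 else 0) - (if c = b - s then 1 else 0) := by
      by_cases e1 : c = b
      · have e2 : c ≠ b - s := by omega
        have e3 : c ∉ betaSet 0 nu := by rw [h3]; tauto
        rw [if_pos (e1 ▸ hb), if_neg e3, if_pos e1, if_neg e2]
      · by_cases e2 : c = b - s
        · rw [if_neg (e2 ▸ hbs), if_pos (h3.2 (Or.inl e2)), if_neg e1, if_pos e2]
        · have e3 : c ∈ betaSet 0 nu ↔ c ∈ betaSet 0 la := by rw [h3]; tauto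
          simp only [e3, if_neg e1, if_neg e2, sub_self]
    omega
  obtain ⟨M, hM⟩ := diagLen_eventually_zero la
  obtain ⟨M', hM'⟩ := diagLen_eventually_zero nu
  -- Downward induction from contents beyond `b` and both diagrams, where everything vanishes.
  have main : ∀ k : ℕ, ∀ c : ℤ, max (max M M') (b + 1) ≤ c + k →
      (diagLen la c : ℤ) = diagLen nu c + if b - s < c ∧ c ≤ b then 1 else 0 := by
    intro k
    induction k with
    | zero =>
      intro c hc
      rw [hM c (by omega), hM' c (by omega), if_neg (by omega)]
      rfl
    | succ k ih =>
      intro c hc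
      have h1 := ih (c + 1) (by push_cast at hc; omega)
      have h2 := step c
      split_ifs at h1 h2 ⊢ <;> omega
  exact main (max (max M M') (b + 1) - c).toNat c (by omega)

/-- Exchanging one element of a beta-set for a new one keeps the charge. -/
theorem betaSet_charge_eq_of_replace {r r' : ℤ} {la nu : YoungDiagram} {b b' : ℤ}
    (hb : b ∈ betaSet r la) (hb' : b' ∉ betaSet r la)
    (hn : betaSet r' nu = insert b' (betaSet r la \ {b})) : r' = r := by
  obtain ⟨K, hK⟩ := betaSet_ncard r la
  obtain ⟨K', hK'⟩ := betaSet_ncard r' nu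
  obtain ⟨N, n1, n2, n3, n4⟩ : ∃ N : ℤ, K ≤ N ∧ K' ≤ N ∧ -N ≤ b ∧ -N ≤ b' :=
    ⟨max (max K K') (max (-b) (-b')), by omega, by omega, by omega, by omega⟩
  have hset : betaSet r' nu ∩ Set.Ici (-N)
      = insert b' ((betaSet r la ∩ Set.Ici (-N)) \ {b}) := by
    ext x
    simp only [hn, Set.mem_inter_iff, Set.mem_insert_iff, Set.mem_sdiff, Set.mem_singleton_iff,
      Set.mem_Ici]
    constructor
    · tauto
    · rintro (rfl | h)
      · exact ⟨Or.inl rfl, n4⟩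
      · tauto
  obtain ⟨M, hM⟩ := betaSet_bddAbove r la
  have hfin : (betaSet r la ∩ Set.Ici (-N)).Finite :=
    (Set.finite_Icc (-N) M).subset fun n hn => ⟨hn.2, hM hn.1⟩
  have h1 := Set.ncard_sdiff_singleton_add_one (a := b)
    (s := betaSet r la ∩ Set.Ici (-N)) ⟨hb, n3⟩ hfin
  have h2 := Set.ncard_insert_of_notMem (a := b')
    (s := (betaSet r la ∩ Set.Ici (-N)) \ {b}) (fun h => hb' h.1.1) hfin.sdiff
  rw [← hset] at h2
  have h3 := hK N n1
  have h4 := hK' N n2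
  omega

theorem exists_betaSet_replace {r : ℤ} {la : YoungDiagram} {b b' : ℤ}
    (hb : b ∈ betaSet r la) (hb' : b' ∉ betaSet r la) :
    ∃ nu, betaSet r nu = insert b' (betaSet r la \ {b}) := by
  obtain ⟨nu, r', h⟩ := exists_betaSet_eq (insert b' (betaSet r la \ {b}))
    (((betaSet_bddAbove r la).mono Set.sdiff_subset).insert b') (by
      refine ((betaSet_compl_bddBelow r la).insert b).mono fun x hx => ?_
      by_contra hc
      simp only [Set.mem_insert_iff, Set.mem_compl_iff, Set.mem_sdiff, Set.mem_singleton_iff]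
        at hx hc
      tauto)
  obtain rfl := betaSet_charge_eq_of_replace hb hb' h
  exact ⟨nu, h⟩

/-- Converse to `RemovesRimHook.exists_betaSet`: the hook consists of the last nodes of the
diagonals `b - s + 1, …, b`. Consecutive ones are adjacent because neighbouring diagonal lengths
differ by at most one, in the direction fixed by the side of the main diagonal. -/
theorem exists_removesRimHook {s : ℕ} {la : YoungDiagram} {b : ℤ}
    (hb : b ∈ betaSet 0 la) (hbs : b - s ∉ betaSet 0 la) : ∃ nu, RemovesRimHook s la nu := by
  classical
  obtain ⟨nu, hnu⟩ := exists_betaSet_replace hb hbs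
  have hn : ∀ n, n ∈ betaSet 0 nu ↔ n = b - s ∨ n ∈ betaSet 0 la ∧ n ≠ b := by
    simp [hnu]
  have hD := diagLen_of_betaSet hb hbs hn
  have hmem := mem_iff_lt_diagLen
  have hla : ∀ x : ℕ × ℕ, x ∈ la ↔ min x.1 x.2 < diagLen la ((x.2 : ℤ) - x.1) :=
    fun x => hmem la x.1 x.2
  have hmem_nu : ∀ x : ℕ × ℕ, x ∈ nu ↔ min x.1 x.2 < diagLen nu ((x.2 : ℤ) - x.1) :=
    fun x => hmem nu x.1 x.2
  -- the last node of the diagonal `c`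
  let f : ℤ → ℕ × ℕ := fun c =>
    (diagLen la c - 1 + (-c).toNat, diagLen la c - 1 + c.toNat)
  have hfc : ∀ c, ((f c).2 : ℤ) - (f c).1 = c := fun c => by simp only [f]; omega
  have hfm : ∀ c, min (f c).1 (f c).2 = diagLen la c - 1 := fun c => by simp only [f]; omega
  let H : Finset (ℕ × ℕ) := (Finset.Ioc (b - s) b).image f
  -- The truncated `diagLen la c - 1` in `f` names a node only on a nonempty diagonal.
  have hpos : ∀ c, b - s < c → c ≤ b → 0 < diagLen la c := fun c h1 h2 => by
    have := hD c
    rw [if_pos ⟨h1, h2⟩] at this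
    omega
  have hH : ∀ x : ℕ × ℕ, x ∈ H ↔ x ∈ la ∧ x ∉ nu := by
    intro x
    simp only [H, Finset.mem_image, Finset.mem_Ioc]
    rw [hla, hmem_nu]
    have hDx := hD ((x.2 : ℤ) - x.1)
    constructor
    · rintro ⟨c, ⟨h1, h2⟩, rfl⟩
      rw [hfc, if_pos ⟨h1, h2⟩] at hDx
      rw [hfc, hfm]
      omega
    · rintro ⟨h1, h2⟩
      have hc : b - s < (x.2 : ℤ) - x.1 ∧ (x.2 : ℤ) - x.1 ≤ b := by
        by_contra hc
        rw [if_neg hc] at hDx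
        omega
      refine ⟨_, hc, ?_⟩
      rw [if_pos hc] at hDx
      have e1 := hfc ((x.2 : ℤ) - x.1)
      have e2 := hfm ((x.2 : ℤ) - x.1)
      ext <;> omega
  have hsub : ∀ x : ℕ × ℕ, x ∈ nu → x ∈ la := by
    intro x
    rw [hla, hmem_nu]
    have := hD ((x.2 : ℤ) - x.1)
    split_ifs at this <;> omega
  refine ⟨nu, H, ?_, ?_, ?_, ?_⟩
  · intro x hx
    obtain ⟨h1, h2⟩ := (hH x).1 hx
    -- If the diagonal of `la` went on past `x`, the diagonal of `nu`, at most one node shorter,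
    -- would still contain `x`.
    refine Finset.mem_filter.2 ⟨h1, fun h3 => h2 ?_⟩
    have h3' := (hla (x.1 + 1, x.2 + 1)).1 h3
    rw [hmem_nu]
    have := hD ((x.2 : ℤ) - x.1)
    simp only [show ((x.2 + 1 : ℕ) : ℤ) - (x.1 + 1 : ℕ) = (x.2 : ℤ) - x.1 by omega] at h3'
    split_ifs at this <;> omega
  · rw [Finset.card_image_of_injective _ (Function.LeftInverse.injective
      (g := fun x : ℕ × ℕ => (x.2 : ℤ) - x.1) hfc), Int.card_Ioc]
    omega
  · have hfH : ∀ c, b - s < c → c ≤ b → f c ∈ H := fun c h1 h2 =>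
      Finset.mem_image_of_mem f (Finset.mem_Ioc.2 ⟨h1, h2⟩)
    have hadj : ∀ c, b - s < c → c + 1 ≤ b → NodeAdj (f c) (f (c + 1)) := by
      intro c h1 h2
      have p1 := hpos c h1 (by omega)
      have p2 := hpos (c + 1) (by omega) h2
      simp only [NodeAdj, f]
      by_cases hc : c < 0
      · have := diagLen_succ_of_neg la hc
        omega
      · have := diagLen_succ_of_nonneg la (not_lt.1 hc)
        omega
    have hsymm : ∀ x y, NodeAdj x y → NodeAdj y x := by
      intro x y h
      unfold NodeAdj at *
      omega
    have hpath : ∀ k : ℕ, ∀ c, b - s < c → c + k ≤ b →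
        Relation.ReflTransGen (fun x y => x ∈ H ∧ y ∈ H ∧ NodeAdj x y) (f c) (f (c + k)) := by
      intro k
      induction k with
      | zero =>
        intro c _ _
        rw [Nat.cast_zero, add_zero]
      | succ k ih =>
        intro c h1 h2
        push_cast at h2 ⊢
        refine (ih c h1 (by omega)).tail ⟨hfH _ (by omega) (by omega),
          hfH _ (by omega) (by omega), ?_⟩
        rw [← add_assoc]
        exact hadj _ (by omega) (by omega)
    intro x hx y hy
    obtain ⟨c, hc, rfl⟩ := Finset.mem_image.1 hx
    obtain ⟨d, hd, rfl⟩ := Finset.mem_image.1 hy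
    rw [Finset.mem_Ioc] at hc hd
    rcases le_total c d with hcd | hcd
    · have := hpath (d - c).toNat c hc.1 (by omega)
      rwa [show c + ((d - c).toNat : ℤ) = d by omega] at this
    · have := hpath (c - d).toNat d hd.1 (by omega)
      rw [show d + ((c - d).toNat : ℤ) = c by omega] at this
      exact Relation.ReflTransGen.mono (fun x y ⟨h1, h2, h3⟩ => ⟨h2, h1, hsymm _ _ h3⟩) _ _
        (Relation.reflTransGen_swap.2 this)
  · ext x
    rw [Finset.mem_sdiff, YoungDiagram.mem_cells, YoungDiagram.mem_cells, hH]
    have := hsub x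
    tauto

/-! ### The `s`-set and the `s`-quotient, read off from the beta-set -/

/-- The beta-set on a residue class: the charge does not change when a rim hook is removed. -/
theorem RemovesRimHook.quotient_charge_eq {s : ℕ} [NeZero s] {la nu : YoungDiagram}
    (h : RemovesRimHook s la nu) {a r r' : ℤ} {la' nu' : YoungDiagram}
    (hla : betaSet r la' = {m : ℤ | a + s * m ∈ betaSet 0 la})
    (hnu : betaSet r' nu' = {m : ℤ | a + s * m ∈ betaSet 0 nu}) : r' = r := by
  have hs : (s : ℤ) ≠ 0 := by exact_mod_cast NeZero.ne s
  obtain ⟨b, hb, hbs, hn⟩ := h.exists_betaSet (NeZero.pos s)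
  -- `b` and `b - s` share a runner, so on the runner of `a` either one bead moves from `k` to `k -
  -- 1` or nothing changes.
  by_cases hab : ∃ k, a + s * k = b
  · obtain ⟨k, rfl⟩ := hab
    have e : a + s * k - s = a + s * (k - 1) := by ring
    rw [e] at hbs hn
    refine betaSet_charge_eq_of_replace (b := k) (b' := k - 1) (la := la') (nu := nu') ?_ ?_ ?_
    · rw [hla]; exact hb
    · rw [hla]; exact hbs
    · ext m
      rw [hnu, hla]
      simp [hn, NeZero.ne s]
  · refine (betaSet_inj (la := nu') (mu := la') ?_).1
    rw [hnu, hla]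
    ext m
    have h1 : a + s * m ≠ b := fun h => hab ⟨m, h⟩
    have h2 : a + s * m ≠ b - s := fun h => hab ⟨m + 1, by linear_combination h⟩
    simp [hn, h1, h2]

theorem mem_betaSet_bot {r n : ℤ} : n ∈ betaSet r ⊥ ↔ n < r := by
  have h0 : ∀ i, (⊥ : YoungDiagram).rowLen i = 0 := fun i => by
    by_contra h
    exact YoungDiagram.notMem_bot (i, 0) (YoungDiagram.mem_iff_lt_rowLen.2 (Nat.pos_of_ne_zero h))
  constructor
  · rintro ⟨i, rfl⟩
    simp only [h0]
    omega
  · intro h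
    exact ⟨(r - 1 - n).toNat, by simp only [h0]; omega⟩

/-- A beta-set closed under subtracting `1` is a half-line. -/
theorem mem_betaSet_iff_lt_of_pred_mem {r : ℤ} {la : YoungDiagram}
    (h : ∀ n ∈ betaSet r la, n - 1 ∈ betaSet r la) (n : ℤ) : n ∈ betaSet r la ↔ n < r := by
  obtain ⟨M, hM⟩ := betaSet_bddAbove r la
  obtain ⟨L, hL⟩ := betaSet_compl_bddBelow r la
  have hne : (betaSet r la).Nonempty := Set.range_nonempty _
  have hmem := Int.csSup_mem hne ⟨M, hM⟩
  have hdown : ∀ k : ℕ, ∀ n ∈ betaSet r la, n - k ∈ betaSet r la := by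
    intro k
    induction k with
    | zero => intro n hn; simpa using hn
    | succ k ih =>
      intro n hn
      have := h _ (ih n hn)
      rwa [show n - (k : ℤ) - 1 = n - (k + 1 : ℕ) by push_cast; ring] at this
  -- A half-line is a beta-set of the empty partition, so `betaSet_inj` identifies its end with `r`.
  have heq : betaSet r la = betaSet (sSup (betaSet r la) + 1) ⊥ := by
    ext m
    rw [mem_betaSet_bot]
    constructor
    · intro hm
      have := le_csSup ⟨M, hM⟩ hm
      omega
    · intro hm
      have := hdown (sSup (betaSet r la) - m).toNat _ hmem
      rwa [show sSup (betaSet r la) - ((sSup (betaSet r la) - m).toNat : ℤ) = m by omega] at this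
  obtain ⟨h1, h2⟩ := betaSet_inj heq
  rw [h2, mem_betaSet_bot]

theorem sub_mem_betaSet_core (s : ℕ) [NeZero s] (la : YoungDiagram) (n : ℤ)
    (hn : n ∈ betaSet 0 (core s la)) : n - s ∈ betaSet 0 (core s la) := by
  by_contra hc
  obtain ⟨nu, hnu⟩ := exists_removesRimHook hn hc
  exact (Classical.choose_spec (exists_isCoreOf s la)).2 nu hnu

theorem betaSet_quotientPart (s : ℕ) [NeZero s] (la : YoungDiagram) (i : ZMod s) :
    ∃ r : ℤ, betaSet r (quotientPart s la i) = {m : ℤ | (i.val : ℤ) + s * m ∈ betaSet 0 la} :=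
  Classical.choose_spec (exists_quotientPart s la i)

theorem charge_core_eq {s : ℕ} [NeZero s] {la : YoungDiagram} {i : ZMod s} {r r' : ℤ}
    (hr : betaSet r (quotientPart s la i) = {m : ℤ | (i.val : ℤ) + s * m ∈ betaSet 0 la})
    (hr' : betaSet r' (quotientPart s (core s la) i)
      = {m : ℤ | (i.val : ℤ) + s * m ∈ betaSet 0 (core s la)}) : r' = r := by
  have hpath := (Classical.choose_spec (exists_isCoreOf s la)).1
  change Relation.ReflTransGen _ la (core s la) at hpath
  generalize core s la = sigma at hpath hr'
  revert r'
  induction hpath with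
  | refl =>
    intro r' hr'
    exact (betaSet_inj (hr'.trans hr.symm)).1
  | @tail mu nu _ hstep ih =>
    intro r' hr'
    obtain ⟨r'', h⟩ := betaSet_quotientPart s mu i
    exact (hstep.quotient_charge_eq h hr').trans (ih h)

/-- The core has the same runner charges as `la`, and each of its runners is a half-line, so the
first gap sits at the charge. -/
theorem sSetElt_eq {s : ℕ} [NeZero s] {la : YoungDiagram} {i : ZMod s} {r : ℤ}
    (hr : betaSet r (quotientPart s la i) = {m : ℤ | (i.val : ℤ) + s * m ∈ betaSet 0 la}) :
    sSetElt s la i = i.val + s * r := by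
  have hs : (0 : ℤ) < s := by exact_mod_cast NeZero.pos s
  obtain ⟨r', hr'⟩ := betaSet_quotientPart s (core s la) i
  obtain rfl := charge_core_eq hr hr'
  have hlt := mem_betaSet_iff_lt_of_pred_mem (r := r') (la := quotientPart s (core s la) i)
    (fun n hn => by
      rw [hr', Set.mem_ofPred_eq] at hn ⊢
      have := sub_mem_betaSet_core s la _ hn
      rwa [show (i.val : ℤ) + s * n - s = i.val + s * (n - 1) by ring] at this)
  have hlt' : ∀ m : ℤ, (i.val : ℤ) + s * m ∈ betaSet 0 (core s la) ↔ m < r' := by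
    intro m
    rw [← hlt, hr', Set.mem_ofPred_eq]
  refine (sSetElt_isLeast s la i).unique ⟨⟨by simp, by rw [hlt']; exact lt_irrefl _⟩, ?_⟩
  rintro n ⟨h1, h2⟩
  obtain ⟨m, rfl⟩ : ∃ m : ℤ, n = i.val + s * m := by
    have : ((n - i.val : ℤ) : ZMod s) = 0 := by simp [h1]
    obtain ⟨m, hm⟩ := (ZMod.intCast_zmod_eq_zero_iff_dvd _ s).1 this
    exact ⟨m, by linear_combination hm⟩
  rw [hlt', not_lt] at h2
  have := mul_le_mul_of_nonneg_left h2 hs.le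
  omega

theorem sSetElt_cast (s : ℕ) [NeZero s] (la : YoungDiagram) (i : ZMod s) :
    ((sSetElt s la i : ℤ) : ZMod s) = i :=
  (sSetElt_isLeast s la i).1.1

theorem betaSet_add (r : ℤ) (la : YoungDiagram) (m q : ℤ) :
    m + q ∈ betaSet (r + q) la ↔ m ∈ betaSet r la := by
  simp only [betaSet, Set.mem_range]
  exact exists_congr fun i => by omega

/-- The `s`-set and the `s`-quotient together describe the beta-set. -/
theorem sSetElt_add_mem_betaSet (s : ℕ) [NeZero s] (la : YoungDiagram) (i : ZMod s) (m : ℤ) :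
    sSetElt s la i + s * m ∈ betaSet 0 la ↔ m ∈ betaSet 0 (quotientPart s la i) := by
  obtain ⟨r, hr⟩ := betaSet_quotientPart s la i
  rw [← betaSet_add 0 _ m r, zero_add, hr, Set.mem_ofPred_eq, sSetElt_eq hr]
  ring_nf

/-- The `s`-set and the `s`-quotient are determined by the beta-set. -/
theorem sSetElt_quotientPart_unique {s : ℕ} [NeZero s] {la nu : YoungDiagram} {e : ℤ}
    (h : ∀ m : ℤ, e + s * m ∈ betaSet 0 la ↔ m ∈ betaSet 0 nu) :
    sSetElt s la (e : ZMod s) = e ∧ quotientPart s la (e : ZMod s) = nu := by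
  obtain ⟨q, hq⟩ : ∃ q : ℤ, sSetElt s la (e : ZMod s) = e + s * q := by
    have : ((sSetElt s la (e : ZMod s) - e : ℤ) : ZMod s) = 0 := by
      rw [Int.cast_sub, sSetElt_cast, sub_self]
    obtain ⟨m, hm⟩ := (ZMod.intCast_zmod_eq_zero_iff_dvd _ s).1 this
    exact ⟨m, by linear_combination hm⟩
  -- Both sides describe the runner seen from `e`; comparing charges forces `q = 0`.
  have heq : betaSet q (quotientPart s la (e : ZMod s)) = betaSet 0 nu := by
    ext m
    rw [← h, show m = (m - q) + q by ring, show q = 0 + q by ring]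
    rw [show m - (0 + q) + (0 + q) = (m - q) + q by ring, betaSet_add,
      ← sSetElt_add_mem_betaSet, hq]
    ring_nf
  obtain ⟨h1, h2⟩ := betaSet_inj heq
  rw [h1, mul_zero, add_zero] at hq
  exact ⟨hq, h2⟩

/-! ### The level action on the integers -/

/-- The displacement under a generator depends only on the class modulo `s`. -/
theorem levelInt_add_mul (s t : ℕ) (hs : 2 ≤ s) (hst : s.Coprime t) (w : AffineSymm s) :
    ∀ n m : ℤ, levelInt s t hs hst w (n + s * m) = levelInt s t hs hst w n + s * m := by
  induction w using (affineMatrix s).toCoxeterSystem.simple_induction with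
  | simple i =>
    intro n m
    rw [CoxeterMatrix.toCoxeterSystem_simple, levelInt_simple]
    change levelFun s t i (n + s * m) = levelFun s t i n + s * m
    have h : ((n + s * m : ℤ) : ZMod s) = n := by simp
    simp only [levelFun, h]
    split_ifs <;> ring
  | one => exact fun n m => by simp
  | mul w w' h h' =>
    intro n m
    rw [map_mul, Equiv.Perm.mul_apply, Equiv.Perm.mul_apply, h', h]

theorem levelInt_cast_eq_iff (s t : ℕ) (hs : 2 ≤ s) (hst : s.Coprime t) (w : AffineSymm s)
    (m n : ℤ) : ((levelInt s t hs hst w m : ℤ) : ZMod s) = (levelInt s t hs hst w n : ℤ)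
      ↔ (m : ZMod s) = n := by
  have key : ∀ a b : ℤ, (a : ZMod s) = b ↔ ∃ k : ℤ, a = b + s * k := fun a b => by
    rw [eq_comm, ZMod.intCast_eq_intCast_iff_dvd_sub]
    exact exists_congr fun k => by constructor <;> intro h <;> linear_combination h
  rw [key, key]
  simp only [← levelInt_add_mul, EmbeddingLike.apply_eq_iff_eq]

theorem levelInt_cast (s t : ℕ) (hs : 2 ≤ s) (hst : s.Coprime t) (w : AffineSymm s) :
    ∀ n : ℤ, ((levelInt s t hs hst w n : ℤ) : ZMod t) = n := by
  induction w using (affineMatrix s).toCoxeterSystem.simple_induction with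
  | simple i =>
    intro n
    rw [CoxeterMatrix.toCoxeterSystem_simple, levelInt_simple]
    change ((levelFun s t i n : ℤ) : ZMod t) = n
    unfold levelFun
    split_ifs <;> simp
  | one => exact fun n => by simp
  | mul w w' h h' =>
    intro n
    rw [map_mul, Equiv.Perm.mul_apply, h, h']

/-! ### Sorting systems of representatives with the generators -/

/-- Going round the cycle, from `0` to `k` and on to `0` again, bounds `f k` on both sides by `f 0`.
-/
theorem ZMod.apply_eq_of_apply_le_add_one {s : ℕ} [NeZero s] {f : ZMod s → ℤ}
    (h : ∀ k, f k ≤ f (k + 1)) (k : ZMod s) : f k = f 0 := by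
  have hup : ∀ (n : ℕ) (k : ZMod s), f k ≤ f (k + n) := by
    intro n
    induction n with
    | zero => intro k; simp
    | succ n ih =>
      intro k
      refine (ih k).trans ?_
      have := h (k + n)
      rwa [add_assoc, ← Nat.cast_succ] at this
  have h1 := hup k.val 0
  have h2 := hup (-k).val k
  rw [ZMod.natCast_zmod_val, zero_add] at h1
  rw [ZMod.natCast_zmod_val, add_neg_cancel] at h2
  exact le_antisymm h2 h1

/-- Two systems of representatives of the residue classes modulo `s` that agree modulo `t` are
related by the level `t` action, up to a common shift. -/
theorem exists_levelInt_add_eq (s t : ℕ) [NeZero s] (hs : 2 ≤ s) (hst : s.Coprime t)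
    (y : ZMod s → ℤ) (hy : Function.Injective fun j => ((y j : ℤ) : ZMod s)) :
    ∀ (x d : ZMod s → ℤ), (Function.Injective fun j => ((x j : ℤ) : ZMod s)) →
      (∀ j, y j = x j + t * d j) →
      ∃ (w : AffineSymm s) (c : ℤ), ∀ j, y j = levelInt s t hs hst w (x j) + c := by
  -- `idx` labels the classes modulo `s` so that adding `t` advances the label by one.
  obtain ⟨idx, h1, h2, h3⟩ := levelFun_index s t hst
  have hone := zmod_one_ne_zero hs
  have hmod : ∀ m n : ℤ, idx m = idx n → (m : ZMod s) = n := by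
    have ht : (t : ℤ) ≠ 0 := by
      rintro h
      rw [Int.natCast_eq_zero.1 h, Nat.coprime_zero_right] at hst
      omega
    -- Read off from the generator `idx n + 1`, which adds `t` to `n`; as `t ≠ 0`, only the first
    -- branch of `levelFun` does so.
    have key : ∀ n : ℤ, (n : ZMod s) = idx n * t
        - ((((s : ℤ) - 1) * ((t : ℤ) - 1) / 2 : ℤ) : ZMod s) := fun n => by
      have h := h3 (idx n + 1) n
      rw [add_sub_cancel_right, if_pos rfl, levelFun, add_sub_cancel_right] at h
      split_ifs at h with c1 c2
      · exact c1
      · omega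
      · omega
    intro m n h
    rw [key m, key n, h]
  have hadd : ∀ n m : ℤ, idx (n + t * m) = idx n + m := by
    intro n m
    induction m using Int.induction_on with
    | zero => simp
    | succ m ih =>
      rw [show n + (t : ℤ) * (m + 1) = n + t * m + t by ring, h1, ih]
      push_cast
      ring
    | pred m ih =>
      rw [show n + (t : ℤ) * (-m - 1) = n + t * -m - t by ring, h2, ih]
      push_cast
      ring
  have hyi : Function.Injective fun j => idx (y j) := fun i j h => hy (hmod _ _ h)
  intro x d
  induction hN : (∑ j, d j ^ 2).toNat using Nat.strong_induction_on generalizing x d with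
  | _ N ih =>
  intro hx hd
  have hxi : Function.Injective fun j => idx (x j) := fun i j h => hx (hmod _ _ h)
  let π : ZMod s ≃ ZMod s := Equiv.ofBijective _ (Finite.injective_iff_bijective.1 hxi)
  have hπ : ∀ k, idx (x (π.symm k)) = k := π.apply_symm_apply
  -- Without a descent in the cyclic order of labels, `d` is constant and the identity element
  -- works.
  by_cases hdesc : ∀ k, d (π.symm k) ≤ d (π.symm (k + 1))
  · refine ⟨1, t * d (π.symm 0), fun j => ?_⟩
    have := ZMod.apply_eq_of_apply_le_add_one hdesc (π j)
    rw [Equiv.symm_apply_apply] at this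
    rw [map_one, Equiv.Perm.one_apply, ← this, hd]
  · push Not at hdesc
    obtain ⟨k, hk⟩ := hdesc
    set p := π.symm k with hp
    set q := π.symm (k + 1) with hq
    have hxp : idx (x p) = k := hπ k
    have hxq : idx (x q) = k + 1 := hπ (k + 1)
    have hpq : p ≠ q := fun h => by rw [h] at hk; exact lt_irrefl _ hk
    -- A descent by exactly one would give `y p` and `y q` the same label.
    have hgap : d q + 2 ≤ d p := by
      by_contra! hlt
      refine hpq (hyi ?_)
      have : d p = d q + 1 := by omega
      simp only [hd, hadd, hxp, hxq, this]
      push_cast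
      ring
    -- apply the generator that exchanges the positions `k` and `k + 1`
    let g := levelGen s t hs hst (k + 1)
    have hg : ∀ j, g (x j) = x j + t * (if j = p then 1 else if j = q then -1 else 0) := by
      intro j
      change levelFun s t (k + 1) (x j) = _
      rw [h3, add_sub_cancel_right]
      have e1 : idx (x j) = k ↔ j = p := ⟨fun h => hxi (h.trans hxp.symm), fun h => h ▸ hxp⟩
      have e2 : idx (x j) = k + 1 ↔ j = q := ⟨fun h => hxi (h.trans hxq.symm), fun h => h ▸ hxq⟩
      simp only [e1, e2]
      split_ifs <;> ring
    let d' : ZMod s → ℤ := fun j => d j - (if j = p then 1 else if j = q then -1 else 0)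
    have hd' : ∀ j, y j = g (x j) + t * d' j := fun j => by
      rw [hg, hd]
      simp only [d']
      ring
    -- The generator lowers `d p` by one and raises `d q` by one; by `hgap` the sum of squares drops
    -- by at least `2`.
    have hsum : ∑ j, d j ^ 2 = ∑ j, d' j ^ 2 + 2 * (d p - d q - 1) := by
      have e : ∀ j, d j ^ 2 = d' j ^ 2 + ((if j = p then 2 * d p - 1 else 0)
          + (if j = q then - 2 * d q - 1 else 0)) := by
        intro j
        simp only [d']
        by_cases c1 : j = p
        · rw [if_pos c1, if_pos c1, if_neg (fun h => hpq (c1.symm.trans h)), c1]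
          ring
        · by_cases c2 : j = q
          · rw [if_neg c1, if_pos c2, if_neg c1, if_pos c2, c2]
            ring
          · rw [if_neg c1, if_neg c2, if_neg c1, if_neg c2]
            ring
      simp only [e, Finset.sum_add_distrib, Finset.sum_ite_eq', Finset.mem_univ, if_true]
      ring
    have hnn : 0 ≤ ∑ j, d' j ^ 2 := Finset.sum_nonneg fun j _ => sq_nonneg _
    have hx' : Function.Injective fun j => ((g (x j) : ℤ) : ZMod s) := by
      intro i j h
      simp only [g, ← levelInt_simple, levelInt_cast_eq_iff] at h
      exact hx h
    obtain ⟨w, c, hw⟩ := ih _ (by omega) (fun j => g (x j)) d' rfl hx' hd'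
    refine ⟨w * (affineMatrix s).simple (k + 1), c, fun j => ?_⟩
    rw [hw, map_mul, levelInt_simple, Equiv.Perm.mul_apply]

/-! ### Weighted quotients and orbits -/

/-- Equal multisets of values mean fibres of equal size, and bijections between fibres glue to a
permutation. -/
theorem Finset.univ_val_map_eq_iff {ι α : Type*} [Fintype ι] (f g : ι → α) :
    (Finset.univ : Finset ι).val.map f = Finset.univ.val.map g
      ↔ ∃ e : Equiv.Perm ι, ∀ i, g (e i) = f i := by
  classical
  constructor
  · intro h
    have hcard : ∀ c, Fintype.card {i // f i = c} = Fintype.card {i // g i = c} := fun c => by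
      have := congrArg (Multiset.count c) h
      rw [Multiset.count_map, Multiset.count_map, ← Finset.filter_val, ← Finset.filter_val,
        Finset.card_val, Finset.card_val] at this
      simpa only [Fintype.card_subtype, eq_comm] using this
    exact ⟨Equiv.ofFiberEquiv fun c => Fintype.equivOfCardEq (hcard c),
      Equiv.ofFiberEquiv_map _⟩
  · rintro ⟨e, he⟩
    conv_rhs => rw [← Multiset.map_univ_val_equiv e, Multiset.map_map]
    exact Multiset.map_congr rfl fun i _ => (he i).symm

/-- The level `t` action permutes the `t`-weighted `s`-quotient. -/
theorem weightedQuotient_levelSMul (s t : ℕ) [NeZero s] (hs : 2 ≤ s) (hst : s.Coprime t)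
    (w : AffineSymm s) (la : YoungDiagram) :
    weightedQuotient s t la = weightedQuotient s t (levelSMul s t hs hst w la) := by
  let g := levelInt s t hs hst w
  let e : ZMod s → ZMod s := fun i => ((g (sSetElt s la i) : ℤ) : ZMod s)
  have he : Function.Injective e := fun i j h => by
    rw [levelInt_cast_eq_iff, sSetElt_cast, sSetElt_cast] at h
    exact h
  refine (Finset.univ_val_map_eq_iff _ _).2
    ⟨Equiv.ofBijective e (Finite.injective_iff_bijective.1 he), fun i => ?_⟩
  -- Translation equivariance carries the runner based at `sSetElt s la i`, bead by bead, to the one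
  -- based at its image under `g`.
  obtain ⟨h1, h2⟩ := sSetElt_quotientPart_unique (la := levelSMul s t hs hst w la)
    (nu := quotientPart s la i) (e := g (sSetElt s la i)) fun m => by
      rw [betaSet_levelSMul, ← sSetElt_add_mem_betaSet, ← levelInt_add_mul]
      exact (levelInt s t hs hst w).injective.mem_set_image
  change (((sSetElt s _ (e i) : ℤ) : ZMod t), quotientPart s _ (e i)) = _
  rw [h1, h2, levelInt_cast]

theorem exists_levelSMul_eq (s t : ℕ) [NeZero s] (hs : 2 ≤ s) (hst : s.Coprime t)
    {la mu : YoungDiagram} (h : weightedQuotient s t la = weightedQuotient s t mu) :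
    ∃ w, levelSMul s t hs hst w la = mu := by
  obtain ⟨e, he⟩ := (Finset.univ_val_map_eq_iff _ _).1 h
  have hq : ∀ i, quotientPart s mu (e i) = quotientPart s la i := fun i => (Prod.mk.inj (he i)).2
  have hd : ∀ i, ∃ d : ℤ, sSetElt s mu (e i) = sSetElt s la i + t * d := fun i => by
    obtain ⟨d, hd⟩ := (ZMod.intCast_eq_intCast_iff_dvd_sub _ _ t).1 (Prod.mk.inj (he i)).1.symm
    exact ⟨d, by linear_combination hd⟩
  choose d hd using hd
  obtain ⟨w, c, hw⟩ := exists_levelInt_add_eq s t hs hst (fun i => sSetElt s mu (e i))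
    (fun i j h => by simpa only [sSetElt_cast, EmbeddingLike.apply_eq_iff_eq] using h)
    (fun i => sSetElt s la i) d (fun i j h => by simpa only [sSetElt_cast] using h) hd
  -- The shift `c` is absorbed as a charge: the image of `la` with charge `c` and `mu` with charge
  -- `0` have the same beta-set, so the partitions agree (and `c = 0`).
  refine ⟨w, (betaSet_inj (r := c) (r' := 0) ?_).2⟩
  ext n
  obtain ⟨i, hi⟩ := e.surjective (n : ZMod s)
  obtain ⟨m, rfl⟩ : ∃ m : ℤ, n = sSetElt s mu (e i) + s * m := by
    rw [← sSetElt_cast s mu (e i), ZMod.intCast_eq_intCast_iff_dvd_sub] at hi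
    obtain ⟨m, hm⟩ := hi
    exact ⟨m, by linear_combination hm⟩
  rw [sSetElt_add_mem_betaSet, hq, ← sSetElt_add_mem_betaSet, hw, add_right_comm, ← levelInt_add_mul]
  have := betaSet_add 0 (levelSMul s t hs hst w la)
    (levelInt s t hs hst w (sSetElt s la i + s * m)) c
  rw [zero_add] at this
  rw [this, betaSet_levelSMul]
  exact (levelInt s t hs hst w).injective.mem_set_image

theorem mainTheorem9 (s t : ℕ) [NeZero s] (hs : 2 ≤ s) (hst : s.Coprime t)
    (la mu : YoungDiagram) :
    mu ∈ levelOrbit s t hs hst la ↔ weightedQuotient s t la = weightedQuotient s t mu := by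
  constructor
  · rintro ⟨w, rfl⟩
    exact weightedQuotient_levelSMul s t hs hst w la
  · exact fun h => exists_levelSMul_eq s t hs hst h
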